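/- Let $n\ge 0$ and $N_s\ge 2$ be integers, let $\mu\in\mathbb{R}^n$, and let $\Sigma\in\mathbb{R}^{n\times n}$ be symmetric positive semidefinite. Let $d_1,\dots,d_{N_s}$ be independent random vectors, each with the Gaussian law $\mathcal{N}(\mu,\Sigma)$, and form the sample mean and the sample covariance $$\hat\mu=\frac1{N_s}\sum_{i=1}^{N_s}d_i,\qquad \hat\Sigma=\frac1{N_s-1}\sum_{i=1}^{N_s}(d_i-\hat\mu)(d_i-\hat\mu)^\top .$$ Let $\beta\in(0,1)$ and put $$r_2=\max\left\{\left|1-\frac{N_s-1}{\chi^2_{N_s-1,1-\beta/2}}\right|,\ \left|1-\frac{N_s-1}{\chi^2_{N_s-1,\beta/2}}\right|\right\},$$ where $\chi^2_{k,p}$ denotes the $p$-th quantile of the chi-squared distribution with $k$ degrees of freedom, that is, of the law of $z_1^2+\dots+z_k^2$ for independent standard normal $z_1,\dots,z_k$. Then, for every fixed (deterministic) $x\in\mathbb{R}^n$, $$\Pr\left(\left|x^\top(\Sigma-\hat\Sigma)x\right|\le r_2\, x^\top\hat\Sigma x\right)\ \ge\ 1-\beta .$$ -/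

import Mathlib

open MeasureTheory ProbabilityTheory Matrix

noncomputable section

/-- The chi-squared distribution with `k` degrees of freedom: the law of `z₁² + ⋯ + z_k²`
for independent standard normal variables `z₁, …, z_k`. -/
def chiSquared (k : ℕ) : Measure ℝ :=
  (Measure.pi fun _ : Fin k => gaussianReal 0 1).map fun z => ∑ i, z i ^ 2

/-- The `p`-th quantile of a probability distribution `ν` on the real line, for `0 < p < 1`. -/
def quantile (ν : Measure ℝ) (p : ℝ) : ℝ :=
  sInf {t : ℝ | p ≤ cdf ν t}

/-- The `p`-th quantile of the chi-squared distribution with `k` degrees of freedom. -/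
def chiSquaredQuantile (k : ℕ) (p : ℝ) : ℝ :=
  quantile (chiSquared k) p

/-- The sample mean of `N` vectors. -/
def sampleMean {n N : ℕ} (d : Fin N → EuclideanSpace ℝ (Fin n)) : EuclideanSpace ℝ (Fin n) :=
  (1 / (N : ℝ)) • ∑ i, d i

/-- The sample covariance matrix of `N` vectors, normalized by `N - 1`. -/
def sampleCovariance {n N : ℕ} (d : Fin N → EuclideanSpace ℝ (Fin n)) :
    Matrix (Fin n) (Fin n) ℝ :=
  (1 / ((N : ℝ) - 1)) •
    ∑ i, vecMulVec (WithLp.ofLp (d i - sampleMean d)) (WithLp.ofLp (d i - sampleMean d))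

/-- The constant `r₂` for `N` samples and confidence level `1 - β`. -/
def covarianceRadius (N : ℕ) (β : ℝ) : ℝ :=
  max |1 - ((N : ℝ) - 1) / chiSquaredQuantile (N - 1) (1 - β / 2)|
    |1 - ((N : ℝ) - 1) / chiSquaredQuantile (N - 1) (β / 2)|

end

/-! Only the scalars `x ⬝ᵥ d i` matter: they are independent Gaussians with common variance `v = x
⬝ᵥ S *ᵥ x`, and the quadratic form of the sample covariance is their sample variance `T / k`, where
`k = N - 1`. If `v > 0`, then `T / v` is chi-squared with `k` degrees of freedom
(`hasLaw_sum_sq_sub_mean_div`), by rotation invariance of the standard Gaussian. It lies between the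
two quantiles with probability at least `1 - β` (`le_measure_Icc_quantile`). There the relative
error `k / (T / v) - 1` is monotone in `T / v`, so its absolute value is largest at an endpoint,
which gives the radius. -/

open Filter Topology in
/-- The cumulative distribution function at the `p`-th quantile is at least `p`. -/
theorem le_cdf_quantile (ν : Measure ℝ) [IsProbabilityMeasure ν] {p : ℝ} (hp1 : p < 1) :
    p ≤ cdf ν (quantile ν p) := by
  have hne : {t : ℝ | p ≤ cdf ν t}.Nonempty :=
    (((tendsto_cdf_atTop ν).eventually (lt_mem_nhds hp1)).exists).imp fun _ h => h.le
  -- Right continuity transfers the bound to the infimum from the points above it.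
  have hright : Tendsto (cdf ν) (𝓝[>] (quantile ν p)) (𝓝 (cdf ν (quantile ν p))) :=
    ((cdf ν).right_continuous _).mono_left (nhdsWithin_mono _ Set.Ioi_subset_Ici_self)
  refine ge_of_tendsto hright ?_
  filter_upwards [self_mem_nhdsWithin] with s hs
  obtain ⟨t, ht, hts⟩ := exists_lt_of_csInf_lt hne hs
  exact le_trans ht (monotone_cdf ν hts.le)

open Filter Topology in
/-- The mass strictly below the `p`-th quantile is at most `p`. -/
theorem measure_Iio_quantile_le (ν : Measure ℝ) [IsProbabilityMeasure ν] {p : ℝ} (hp0 : 0 < p) :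
    ν (Set.Iio (quantile ν p)) ≤ ENNReal.ofReal p := by
  have hbdd : BddBelow {t : ℝ | p ≤ cdf ν t} := by
    obtain ⟨a, ha⟩ := ((tendsto_cdf_atBot ν).eventually (gt_mem_nhds hp0)).exists
    exact ⟨a, fun t ht => le_of_not_gt fun hta =>
      absurd (le_trans ht (monotone_cdf ν hta.le)) (not_le.2 ha)⟩
  rw [← measure_cdf ν, (cdf ν).measure_Iio (tendsto_cdf_atBot ν), measure_cdf, sub_zero]
  refine ENNReal.ofReal_le_ofReal
    (le_of_tendsto ((monotone_cdf ν).tendsto_leftLim (quantile ν p)) ?_)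
  filter_upwards [self_mem_nhdsWithin] with s hs
  exact le_of_not_ge fun h => absurd (csInf_le hbdd h) (not_le.2 hs)

/-- The mass strictly above the `p`-th quantile is at most `1 - p`. -/
theorem measure_Ioi_quantile_le (ν : Measure ℝ) [IsProbabilityMeasure ν] {p : ℝ} (hp1 : p < 1) :
    ν (Set.Ioi (quantile ν p)) ≤ ENNReal.ofReal (1 - p) := by
  rw [← Set.compl_Iic, prob_compl_eq_one_sub measurableSet_Iic, ← ofReal_cdf,
    ← ENNReal.ofReal_one, ← ENNReal.ofReal_sub _ (cdf_nonneg ν _)]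
  exact ENNReal.ofReal_le_ofReal (by linarith [le_cdf_quantile ν hp1])

/-- The quantiles of a distribution carried by the positive reals are positive. -/
theorem quantile_pos (ν : Measure ℝ) [IsProbabilityMeasure ν] (hν : ν (Set.Iic 0) = 0) {p : ℝ}
    (hp0 : 0 < p) (hp1 : p < 1) : 0 < quantile ν p := by
  by_contra! h
  have h1 := (le_cdf_quantile ν hp1).trans (monotone_cdf ν h)
  rw [cdf_eq_real, measureReal_def, hν, ENNReal.toReal_zero] at h1
  linarith

/-- The central interval between the quantiles of levels `β / 2` and `1 - β / 2` has mass at least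
`1 - β`. -/
theorem le_measure_Icc_quantile (ν : Measure ℝ) [IsProbabilityMeasure ν] {β : ℝ} (hβ0 : 0 < β) :
    ENNReal.ofReal (1 - β) ≤
      ν (Set.Icc (quantile ν (β / 2)) (quantile ν (1 - β / 2))) := by
  have hlo := measure_Iio_quantile_le ν (half_pos hβ0)
  have hhi := measure_Ioi_quantile_le ν (p := 1 - β / 2) (by linarith)
  rw [sub_sub_cancel] at hhi
  have hcompl : ν (Set.Icc (quantile ν (β / 2)) (quantile ν (1 - β / 2)))ᶜ ≤ ENNReal.ofReal β := by
    calc ν (Set.Icc (quantile ν (β / 2)) (quantile ν (1 - β / 2)))ᶜ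
        ≤ ν (Set.Iio (quantile ν (β / 2)) ∪ Set.Ioi (quantile ν (1 - β / 2))) := by
          rw [← Set.Ici_inter_Iic, Set.compl_inter, Set.compl_Ici, Set.compl_Iic]
      _ ≤ ENNReal.ofReal (β / 2) + ENNReal.ofReal (β / 2) :=
          (measure_union_le _ _).trans (add_le_add hlo hhi)
      _ = ENNReal.ofReal β := by
          rw [← ENNReal.ofReal_add (by linarith) (by linarith), add_halves]
  rw [ENNReal.ofReal_sub _ hβ0.le, ENNReal.ofReal_one, tsub_le_iff_right]
  calc (1 : ENNReal) = ν (Set.Icc (quantile ν (β / 2)) (quantile ν (1 - β / 2))) +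
        ν (Set.Icc (quantile ν (β / 2)) (quantile ν (1 - β / 2)))ᶜ :=
        (prob_add_prob_compl measurableSet_Icc).symm
    _ ≤ _ := by gcongr

instance isProbabilityMeasure_chiSquared (k : ℕ) : IsProbabilityMeasure (chiSquared k) :=
  Measure.isProbabilityMeasure_map (Measurable.aemeasurable (by fun_prop))

/-- A vanishing sum of squares puts `z` in a coordinate hyperplane, a null set. For `k = 0` the law
is the Dirac mass at `0`. -/
theorem chiSquared_Iic_zero {k : ℕ} (hk : 0 < k) : chiSquared k (Set.Iic 0) = 0 := by
  rw [chiSquared, Measure.map_apply (by fun_prop) measurableSet_Iic]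
  have : NullSingletonClass (gaussianReal 0 1) := nullSingletonClass_gaussianReal one_ne_zero
  refine measure_mono_null (fun z hz => ?_)
    (Measure.pi_hyperplane (fun _ : Fin k => gaussianReal 0 1) ⟨0, hk⟩ 0)
  have hz0 : ∑ i, z i ^ 2 = 0 := le_antisymm hz (Finset.sum_nonneg fun i _ => sq_nonneg (z i))
  exact pow_eq_zero_iff two_ne_zero |>.1
    ((Finset.sum_eq_zero_iff_of_nonneg fun i _ => sq_nonneg (z i)).1 hz0 ⟨0, hk⟩ (Finset.mem_univ _))

/-- The sum of squared deviations from the mean, as the sum of squares minus the square of the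
component along the normalized constant vector. -/
theorem sum_sq_sub_mean_eq {N : ℕ} (hN : N ≠ 0) (y : Fin N → ℝ) :
    ∑ i, (y i - (∑ j, y j) / N) ^ 2 = ∑ i, y i ^ 2 - (∑ i, y i * (√N)⁻¹) ^ 2 := by
  have hN' : (N : ℝ) ≠ 0 := Nat.cast_ne_zero.2 hN
  simp only [sub_sq, Finset.sum_add_distrib, Finset.sum_sub_distrib, ← Finset.sum_mul,
    ← Finset.mul_sum, Finset.sum_const, Finset.card_univ, Fintype.card_fin, nsmul_eq_mul, mul_pow,
    inv_pow, Real.sq_sqrt (Nat.cast_nonneg N)]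
  field_simp
  ring

/-- For `k + 1` independent standard normal variables, the sum of the squared deviations from their
mean has the chi-squared distribution with `k` degrees of freedom. -/
theorem map_sum_sq_sub_mean_pi_gaussianReal (k : ℕ) :
    (Measure.pi fun _ : Fin (k + 1) => gaussianReal 0 1).map
      (fun y => ∑ i, (y i - (∑ j, y j) / ((k + 1 : ℕ) : ℝ)) ^ 2) = chiSquared k := by
  set E := EuclideanSpace ℝ (Fin (k + 1))
  let u : E := WithLp.toLp 2 fun _ => (√((k + 1 : ℕ) : ℝ))⁻¹
  have hu : ‖u‖ = 1 := by
    rw [← sq_eq_sq₀ (norm_nonneg u) zero_le_one, EuclideanSpace.real_norm_sq_eq]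
    simp only [u, Finset.sum_const, Finset.card_univ, Fintype.card_fin, nsmul_eq_mul, inv_pow,
      Real.sq_sqrt (Nat.cast_nonneg (k + 1))]
    field_simp
  -- The family `v` is constant, but only its restriction to `{0}` has to be orthonormal.
  obtain ⟨b, hb⟩ := Orthonormal.exists_orthonormalBasis_extension_of_card_eq
    (𝕜 := ℝ) (E := E) (ι := Fin (k + 1)) (by simp [E]) (v := fun _ => u) (s := {0})
    ⟨fun _ => hu, fun i j hij => absurd (Subsingleton.elim i j) hij⟩
  have hb0 : b 0 = u := hb 0 rfl
  let G (y : Fin (k + 1) → ℝ) : ℝ := ∑ i, (y i - (∑ j, y j) / ((k + 1 : ℕ) : ℝ)) ^ 2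
  have hG : Measurable G := by fun_prop
  let F (y : E) : ℝ := G y
  have hF : Measurable F := hG.comp (WithLp.measurable_ofLp 2 _)
  -- In the basis `b`, subtracting the mean deletes coordinate `0`, which costs one degree of
  -- freedom.
  have hFb (z : Fin (k + 1) → ℝ) : F (∑ i, z i • b i) = ∑ i : Fin k, z i.succ ^ 2 := by
    set y : E := ∑ i, z i • b i
    have hcoord (i) : inner ℝ (b i) y = z i := by
      rw [← b.repr_apply_apply]
      simp [y, b.repr_self, Finset.sum_apply, Pi.single_apply]
    have hnorm : ∑ i : Fin (k + 1), y i ^ 2 = ∑ i, z i ^ 2 := by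
      rw [← EuclideanSpace.real_norm_sq_eq, ← b.sum_sq_inner_right]
      simp only [hcoord]
    have hmean : ∑ i : Fin (k + 1), y i * (√((k + 1 : ℕ) : ℝ))⁻¹ = z 0 := by
      rw [← hcoord 0, hb0, PiLp.inner_apply]
      simp [u]
    change ∑ i : Fin (k + 1), (y i - (∑ j : Fin (k + 1), y j) / ((k + 1 : ℕ) : ℝ)) ^ 2 = _
    rw [sum_sq_sub_mean_eq k.succ_ne_zero, hnorm, hmean, Fin.sum_univ_succ, add_sub_cancel_left]
  have htail : (Measure.pi fun _ : Fin (k + 1) => gaussianReal 0 1).map (fun z i => z (Fin.succ i))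
      = Measure.pi fun _ : Fin k => gaussianReal 0 1 :=
    (measurePreserving_snd.comp
      (measurePreserving_piFinSuccAbove (fun _ : Fin (k + 1) => gaussianReal 0 1) 0)).map_eq
  calc (Measure.pi fun _ : Fin (k + 1) => gaussianReal 0 1).map
        (fun y => ∑ i, (y i - (∑ j, y j) / ((k + 1 : ℕ) : ℝ)) ^ 2)
      = ((Measure.pi fun _ : Fin (k + 1) => gaussianReal 0 1).map (WithLp.toLp 2)).map F := by
        rw [Measure.map_map hF (by fun_prop)]
        rfl
    -- Independent standard normal coordinates give the same law in every orthonormal basis.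
    _ = ((Measure.pi fun _ : Fin (k + 1) => gaussianReal 0 1).map
          fun z => ∑ i, z i • b i).map F := by
        rw [map_pi_eq_stdGaussian, ← stdGaussian_eq_map_pi_orthonormalBasis]
    _ = (Measure.pi fun _ : Fin (k + 1) => gaussianReal 0 1).map
          fun z => ∑ i : Fin k, z i.succ ^ 2 := by
        rw [Measure.map_map hF (by fun_prop)]
        exact congrArg (fun f => Measure.map f _) (funext hFb)
    _ = ((Measure.pi fun _ : Fin (k + 1) => gaussianReal 0 1).map
          fun z i => z (Fin.succ i)).map fun z => ∑ i, z i ^ 2 := by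
        rw [Measure.map_map (by fun_prop) (by fun_prop)]
        rfl
    _ = chiSquared k := by rw [htail, chiSquared]

/-- The quadratic form of the sample covariance is the sample variance of the projected data. -/
theorem dotProduct_sampleCovariance_mulVec {n N : ℕ} (d : Fin N → EuclideanSpace ℝ (Fin n))
    (x : Fin n → ℝ) :
    x ⬝ᵥ (sampleCovariance d *ᵥ x) =
      (1 / ((N : ℝ) - 1)) * ∑ i, (x ⬝ᵥ d i - (∑ j, x ⬝ᵥ d j) / N) ^ 2 := by
  have hmean : x ⬝ᵥ WithLp.ofLp (sampleMean d) = (∑ j, x ⬝ᵥ d j) / N := by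
    rw [sampleMean, WithLp.ofLp_smul, WithLp.ofLp_sum 2, dotProduct_smul, dotProduct_sum, smul_eq_mul]
    ring
  rw [sampleCovariance, smul_mulVec, dotProduct_smul, smul_eq_mul, sum_mulVec, dotProduct_sum]
  congr 1
  refine Finset.sum_congr rfl fun i _ => ?_
  rw [← hmean, ← dotProduct_sub, ← WithLp.ofLp_sub 2, vecMulVec_mulVec, sq]
  simp [dotProduct_comm x]

/-- A linear functional of a multivariate Gaussian vector is Gaussian. -/
theorem hasLaw_dotProduct_multivariateGaussian {Ω : Type*} [MeasurableSpace Ω] {P : Measure Ω}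
    {n : ℕ} {μ : EuclideanSpace ℝ (Fin n)} {S : Matrix (Fin n) (Fin n) ℝ} (hS : S.PosSemidef)
    {d : Ω → EuclideanSpace ℝ (Fin n)} (hd : HasLaw d (multivariateGaussian μ S) P)
    (x : Fin n → ℝ) :
    HasLaw (fun ω => x ⬝ᵥ d ω) (gaussianReal (x ⬝ᵥ μ) (x ⬝ᵥ S *ᵥ x).toNNReal) P := by
  set L : StrongDual ℝ (EuclideanSpace ℝ (Fin n)) := innerSL ℝ (WithLp.toLp 2 x)
  have hL (y : EuclideanSpace ℝ (Fin n)) : L y = x ⬝ᵥ y := by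
    simp [L, PiLp.inner_apply, dotProduct, mul_comm]
  have hlaw : HasLaw L (gaussianReal (x ⬝ᵥ μ) (x ⬝ᵥ S *ᵥ x).toNNReal)
      (multivariateGaussian μ S) := by
    refine ⟨by fun_prop, ?_⟩
    rw [IsGaussian.map_eq_gaussianReal, L.integral_comp_id_comm IsGaussian.integrable_id,
      integral_id_multivariateGaussian, hL, ← covariance_self (by fun_prop)]
    congr 2
    exact (covarianceBilin_apply_eq_cov IsGaussian.memLp_two_id _ _).symm.trans
      (covarianceBilin_multivariateGaussian hS (WithLp.toLp 2 x) (WithLp.toLp 2 x))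
  simpa only [Function.comp_def, hL] using hlaw.comp hd

/-- For `k + 1` independent Gaussian variables with common mean and variance `v ≠ 0`, the sum of
the squared deviations from the mean, divided by `v`, is chi-squared with `k` degrees of freedom. -/
theorem hasLaw_sum_sq_sub_mean_div {Ω : Type*} [MeasurableSpace Ω] {P : Measure Ω} {k : ℕ}
    {m : ℝ} {v : NNReal} (hv : v ≠ 0) {X : Fin (k + 1) → Ω → ℝ}
    (hX : ∀ i, HasLaw (X i) (gaussianReal m v) P) (hindep : iIndepFun X P) :
    HasLaw (fun ω => (∑ i, (X i ω - (∑ j, X j ω) / ((k + 1 : ℕ) : ℝ)) ^ 2) / v)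
      (chiSquared k) P := by
  have hv' : (0 : ℝ) < v := by positivity
  have hs : √(v : ℝ) ≠ 0 := (Real.sqrt_pos.2 hv').ne'
  have hY (i) : HasLaw (fun ω => (X i ω - m) / √v) (gaussianReal 0 1) P := by
    convert gaussianReal_div_const (gaussianReal_sub_const (hX i) m) (√v) using 2
    · simp
    · ext
      simp [Real.sq_sqrt hv'.le, hv]
  have hYind : iIndepFun (fun i ω => (X i ω - m) / √v) P :=
    hindep.comp (fun _ t => (t - m) / √v) fun _ => by fun_prop
  have hQ : HasLaw (fun y : Fin (k + 1) → ℝ => ∑ i, (y i - (∑ j, y j) / ((k + 1 : ℕ) : ℝ)) ^ 2)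
      (chiSquared k) (Measure.pi fun _ => gaussianReal 0 1) :=
    ⟨by fun_prop, map_sum_sq_sub_mean_pi_gaussianReal k⟩
  convert hQ.comp (hYind.hasLaw_pi hY) using 1
  funext ω
  simp only [Function.comp_apply]
  rw [Finset.sum_div]
  refine Finset.sum_congr rfl fun i _ => ?_
  rw [← Finset.sum_div, Finset.sum_sub_distrib]
  simp only [Finset.sum_const, Finset.card_univ, Fintype.card_fin, nsmul_eq_mul]
  have hk : ((k + 1 : ℕ) : ℝ) ≠ 0 := by positivity
  have : (X i ω - m) / √v - ((∑ j, X j ω) - ((k + 1 : ℕ) : ℝ) * m) / √v / ((k + 1 : ℕ) : ℝ)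
      = (X i ω - (∑ j, X j ω) / ((k + 1 : ℕ) : ℝ)) / √v := by
    field_simp
    ring
  rw [this, div_pow, Real.sq_sqrt hv'.le]

/-- If `q` lies between `a > 0` and `b`, then `c / q` deviates from `1` at most as much as one of
`c / a` and `c / b`. -/
theorem abs_div_sub_one_le_max {a b c q : ℝ} (ha : 0 < a) (hc : 0 ≤ c) (haq : a ≤ q)
    (hqb : q ≤ b) : |c / q - 1| ≤ max |1 - c / b| |1 - c / a| := by
  have hq : 0 < q := ha.trans_le haq
  have h1 : c / b ≤ c / q := div_le_div_of_nonneg_left hc hq hqb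
  have h2 : c / q ≤ c / a := div_le_div_of_nonneg_left hc ha haq
  rw [abs_sub_comm, max_comm]
  exact abs_le_max_abs_abs (by linarith) (by linarith)

theorem lemma3 {Ω : Type*} [MeasurableSpace Ω] (P : Measure Ω) [IsProbabilityMeasure P]
    {n N : ℕ} (hN : 2 ≤ N)
    (μ : EuclideanSpace ℝ (Fin n)) (S : Matrix (Fin n) (Fin n) ℝ) (hS : S.PosSemidef)
    (d : Fin N → Ω → EuclideanSpace ℝ (Fin n))
    (hd : ∀ i, HasLaw (d i) (multivariateGaussian μ S) P)
    (hindep : iIndepFun d P)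
    (β : ℝ) (hβ : β ∈ Set.Ioo (0 : ℝ) 1) (x : Fin n → ℝ) :
    ENNReal.ofReal (1 - β) ≤
      P {ω | |x ⬝ᵥ ((S - sampleCovariance fun i => d i ω) *ᵥ x)| ≤
        (x ⬝ᵥ ((sampleCovariance fun i => d i ω) *ᵥ x)) * covarianceRadius N β} := by
  obtain ⟨k, rfl⟩ : ∃ k, N = k + 1 := ⟨N - 1, by omega⟩
  have hk : 0 < k := by omega
  have hk' : (0 : ℝ) < k := Nat.cast_pos.2 hk
  have hX (i) := hasLaw_dotProduct_multivariateGaussian hS (hd i) x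
  have hXind : iIndepFun (fun i ω => x ⬝ᵥ d i ω) P :=
    hindep.comp (fun _ y => x ⬝ᵥ y) fun _ => by
      unfold dotProduct
      fun_prop
  have hv0 : 0 ≤ x ⬝ᵥ S *ᵥ x := by simpa using hS.dotProduct_mulVec_nonneg x
  simp only [sub_mulVec, dotProduct_sub, dotProduct_sampleCovariance_mulVec]
  generalize x ⬝ᵥ S *ᵥ x = v at hX hv0 ⊢
  have hsub : ((k + 1 : ℕ) : ℝ) - 1 = k := by push_cast; ring
  obtain rfl | hv := hv0.eq_or_lt
  -- Zero variance rules out dividing by `v`, but the projected data are then almost surely constant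
  -- and both sides of the inequality vanish.
  · have hconst (i) : ∀ᵐ ω ∂P, x ⬝ᵥ d i ω = x ⬝ᵥ μ := by
      have h := (hX i).map_eq
      rw [Real.toNNReal_zero, gaussianReal_zero_var] at h
      refine ae_of_ae_map (hX i).aemeasurable (p := fun t => t = x ⬝ᵥ μ) ?_
      rw [h, ae_dirac_eq]
      exact rfl
    calc ENNReal.ofReal (1 - β) ≤ P Set.univ := by
          rw [measure_univ]
          exact ENNReal.ofReal_le_one.2 (by linarith [hβ.1])
      _ ≤ _ := measure_mono_ae ?_
    filter_upwards [ae_all_iff.2 hconst] with ω hω _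
    have hk1 : ((k + 1 : ℕ) : ℝ) ≠ 0 := by positivity
    change |_| ≤ _
    simp only [hω, Finset.sum_const, Finset.card_univ, Fintype.card_fin,
      nsmul_eq_mul, mul_div_cancel_left₀ _ hk1]
    simp
  · have hQ := hasLaw_sum_sq_sub_mean_div (Real.toNNReal_pos.2 hv).ne' hX hXind
    rw [Real.coe_toNNReal v hv.le] at hQ
    have hqpos : 0 < chiSquaredQuantile k (β / 2) :=
      quantile_pos _ (chiSquared_Iic_zero hk) (by linarith [hβ.1]) (by linarith [hβ.2])
    refine (le_measure_Icc_quantile (chiSquared k) hβ.1).trans ?_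
    rw [← hQ.map_eq, Measure.map_apply_of_aemeasurable hQ.aemeasurable measurableSet_Icc, hQ.map_eq]
    refine measure_mono fun ω hω => ?_
    rw [Set.mem_preimage, Set.mem_Icc] at hω
    rw [Set.mem_ofPred_eq, covarianceRadius, Nat.add_sub_cancel, hsub]
    generalize (∑ i, (x ⬝ᵥ d i ω - (∑ j, x ⬝ᵥ d j ω) / ((k + 1 : ℕ) : ℝ)) ^ 2) = T at hω ⊢
    have hTv : 0 < T / v := hqpos.trans_le hω.1
    have hT : 0 < T := by rwa [div_pos_iff_of_pos_right hv] at hTv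
    have hbound := abs_div_sub_one_le_max hqpos hk'.le hω.1 hω.2
    -- Pulling out the sample variance `T / k` leaves the relative error bounded by `hbound`.
    have hfactor : v - 1 / (k : ℝ) * T = (1 / (k : ℝ) * T) * (k / (T / v) - 1) := by
      field_simp
    have hpos : 0 < 1 / (k : ℝ) * T := by positivity
    rw [hfactor, abs_mul, abs_of_pos hpos]
    exact mul_le_mul_of_nonneg_left hbound hpos.le
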